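/- Let $\mathfrak A$ be a complex unital algebra and let $\varphi,\psi:\mathfrak A\to\mathbb C$ be linear functionals with $\varphi(1)=\psi(1)=1$. Two elements $X,Y\in\mathfrak A$ are called \emph{c-free} in $(\mathfrak A,\varphi,\psi)$ if, with $\mathfrak A_1,\mathfrak A_2$ the unital subalgebras generated by $X$ and by $Y$, one has $$\psi(a_1\cdots a_n)=0\quad\text{and}\quad \varphi(a_1\cdots a_n)=\varphi(a_1)\cdots\varphi(a_n)$$ whenever $n\ge 1$, $a_j\in\mathfrak A_{\varepsilon(j)}$ with $\varepsilon(j)\in\{1,2\}$, $\varepsilon(j)\ne\varepsilon(j+1)$ for $1\le j<n$, and $\psi(a_j)=0$ for all $j$. For $n\ge 1$ the free cumulants $R^n$ and the c-free cumulants ${}^cR^n$ are the functions of $n$ elements of $\mathfrak A$ determined by the recurrences $$\psi(a_1\cdots a_n)=\sum_{p=1}^n\ \sum_{1=i(1)<\cdots<i(p)\le n} R^p(a_{i(1)},\dots,a_{i(p)})\Big[\prod_{k=1}^{p-1}\psi(a_{i(k)+1}\cdots a_{i(k+1)-1})\Big]\psi(a_{i(p)+1}\cdots a_n),$$ $$\varphi(a_1\cdots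 a_n)=\sum_{p=1}^n\ \sum_{1=i(1)<\cdots<i(p)\le n} {}^cR^p(a_{i(1)},\dots,a_{i(p)})\Big[\prod_{k=1}^{p-1}\psi(a_{i(k)+1}\cdots a_{i(k+1)-1})\Big]\varphi(a_{i(p)+1}\cdots a_n),$$ where empty products equal $1$. For $X\in\mathfrak A$ define the formal power series $$R_X(z)=\sum_{n\ge1}R^n(X,\dots,X)z^n,\qquad {}^cR_X(z)=\sum_{n\ge1}{}^cR^n(X,\dots,X)z^n.$$ Since $R_X(z)=\psi(X)z+O(z^2)$, if $\psi(X)\ne0$ then $R_X$ has an inverse $R_X^{\langle-1\rangle}$ with respect to substitution, and the c-free $T$-transform of $X$ is the formal power series $${}^cT_X=\Big(\tfrac1z\,{}^cR_X\Big)\circ R_X^{\langle-1\rangle}.$$ \textbf{Theorem.} If $X,Y\in\mathfrak A$ are c-free in $(\mathfrak A,\varphi,\psi)$ and $\psi(X)\ne0\ne\psi(Y)$, then $\psi(XY)\ne0$, so that ${}^cT_{XY}$ is defined, and $${}^cT_{XY}(z)={}^cT_X(z)\cdot{}^cT_Y(z)$$ as formal power series. -/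

import Mathlib

noncomputable section

namespace CFreeProb

variable {A : Type*} [Ring A] [Algebra ℂ A]

/-- A family of unital subalgebras `B i` is conditionally free with respect to `(φ, ψ)`: for every
nonempty word `a 0, …, a n` with `a j ∈ B (ε j)`, neighbouring indices distinct and `ψ (a j) = 0`
for all `j`, one has `ψ (a 0 ⋯ a n) = 0` and `φ (a 0 ⋯ a n) = φ (a 0) ⋯ φ (a n)`. -/
def CFree {ι : Type*} (φ ψ : A →ₗ[ℂ] ℂ) (B : ι → Subalgebra ℂ A) : Prop :=
  ∀ (n : ℕ) (ε : Fin (n + 1) → ι) (a : Fin (n + 1) → A),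
    (∀ j, a j ∈ B (ε j)) → (∀ j : Fin n, ε j.castSucc ≠ ε j.succ) → (∀ j, ψ (a j) = 0) →
      ψ (List.ofFn a).prod = 0 ∧ φ (List.ofFn a).prod = ∏ j, φ (a j)

/-- Two elements are conditionally free if the unital subalgebras they generate are. -/
def CFreePair (φ ψ : A →ₗ[ℂ] ℂ) (X Y : A) : Prop :=
  CFree φ ψ ![Algebra.adjoin ℂ {X}, Algebra.adjoin ℂ {Y}]

/-! Index sets `1 = i(1) < ⋯ < i(p) ≤ n` are encoded as compositions `c` of `n` with `p` blocks:
the `k`-th block is the interval that starts at `i(k)` and ends just before `i(k+1)`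
(at `n` for the last one). -/

/-- The position `i(k)`, the first element of the `k`-th block. -/
def start {n : ℕ} (c : Composition n) (k : Fin c.length) : Fin n :=
  c.embedding k ⟨0, c.one_le_blocksFun k⟩

/-- The ordered product `a_{i(k)+1} ⋯ a_{i(k+1)-1}` (`a_{i(p)+1} ⋯ a_n` for the last block) of the
entries of the `k`-th block other than its first one. The empty product is `1`. -/
def gap {n : ℕ} (a : Fin n → A) (c : Composition n) (k : Fin c.length) : A :=
  (List.ofFn fun j => a (c.embedding k j)).tail.prod

/-- The free cumulant `R^n(a_1, …, a_n)` of `ψ`, for `n ≥ 1`: the recurrence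
`freeCumulant_recurrence` below, solved for the term with `p = n`.
(The value at `n = 0` has no meaning and is not used.) -/
def freeCumulant (ψ : A →ₗ[ℂ] ℂ) : (n : ℕ) → (Fin n → A) → ℂ
  | n, a => ψ (List.ofFn a).prod -
      ∑ c : {c : Composition n // c.length < n},
        freeCumulant ψ c.1.length (fun k => a (start c.1 k)) * ∏ k, ψ (gap a c.1 k)
termination_by n => n
decreasing_by exact c.2

/-- The c-free cumulant `ᶜR^n(a_1, …, a_n)` of `(φ, ψ)`, for `n ≥ 1`: the recurrence
`cFreeCumulant_recurrence` below, solved for the term with `p = n`.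
(The value at `n = 0` has no meaning and is not used.) -/
def cFreeCumulant (φ ψ : A →ₗ[ℂ] ℂ) : (n : ℕ) → (Fin n → A) → ℂ
  | n, a => φ (List.ofFn a).prod -
      ∑ c : {c : Composition n // c.length < n},
        cFreeCumulant φ ψ c.1.length (fun k => a (start c.1 k)) *
          ∏ k : Fin c.1.length,
            (if (k : ℕ) + 1 = c.1.length then φ (gap a c.1 k) else ψ (gap a c.1 k))
termination_by n => n
decreasing_by exact c.2

lemma gap_ones {A : Type*} [Ring A] {n : ℕ} (a : Fin n → A) (k : Fin (Composition.ones n).length) :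
    gap a (Composition.ones n) k = 1 := by
  simp [gap]

lemma sum_composition_split {n : ℕ} (F : Composition n → ℂ) :
    ∑ c, F c = F (Composition.ones n) +
      ∑ c : {c : Composition n // c.length < n}, F c.1 := by
  classical
  rw [← Finset.add_sum_erase _ _ (Finset.mem_univ (Composition.ones n))]
  congr 1
  refine Finset.sum_subtype _ (fun c => ?_) F
  have := c.length_le
  simp only [Finset.mem_erase, Finset.mem_univ, and_true, ne_eq, Composition.eq_ones_iff_length]
  omega

lemma cumulant_ones {A : Type*} (K : (n : ℕ) → (Fin n → A) → ℂ) {n : ℕ} (a : Fin n → A) :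
    K (Composition.ones n).length (fun k => a (start (Composition.ones n) k)) = K n a := by
  have key : ∀ (m : ℕ) (h : m = n) (b : Fin m → A), (∀ k, b k = a (Fin.cast h k)) →
      K m b = K n a := by
    rintro m rfl b hb
    congr 1
    funext k
    simpa using hb k
  refine key _ (Composition.ones_length n) _ (fun k => ?_)
  rw [start, Composition.ones_embedding]
  rfl

/-- The moment-cumulant recurrence that defines the free cumulants. -/
theorem freeCumulant_recurrence (ψ : A →ₗ[ℂ] ℂ) (hψ : ψ 1 = 1) (n : ℕ) (a : Fin n → A) :
    ψ (List.ofFn a).prod =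
      ∑ c : Composition n,
        freeCumulant ψ c.length (fun k => a (start c k)) * ∏ k, ψ (gap a c k) := by
  rw [sum_composition_split, cumulant_ones (freeCumulant ψ)]
  simp only [gap_ones, hψ, Finset.prod_const_one, mul_one]
  rw [freeCumulant]
  ring

/-- The moment-cumulant recurrence that defines the c-free cumulants. -/
theorem cFreeCumulant_recurrence (φ ψ : A →ₗ[ℂ] ℂ) (hφ : φ 1 = 1) (hψ : ψ 1 = 1)
    (n : ℕ) (a : Fin n → A) :
    φ (List.ofFn a).prod =
      ∑ c : Composition n,
        cFreeCumulant φ ψ c.length (fun k => a (start c k)) *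
          ∏ k : Fin c.length,
            (if (k : ℕ) + 1 = c.length then φ (gap a c k) else ψ (gap a c k)) := by
  rw [sum_composition_split, cumulant_ones (cFreeCumulant φ ψ)]
  simp only [gap_ones, hφ, hψ, ite_self, Finset.prod_const_one, mul_one]
  rw [cFreeCumulant]
  ring

/-- `R_X(z) = ∑_{n ≥ 1} R^n(X, …, X) z^n`. -/
def RTransform (ψ : A →ₗ[ℂ] ℂ) (X : A) : PowerSeries ℂ :=
  PowerSeries.mk fun n => if n = 0 then 0 else freeCumulant ψ n fun _ => X

/-- `ᶜR_X(z) = ∑_{n ≥ 1} ᶜR^n(X, …, X) z^n`. -/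
def cRTransform (φ ψ : A →ₗ[ℂ] ℂ) (X : A) : PowerSeries ℂ :=
  PowerSeries.mk fun n => if n = 0 then 0 else cFreeCumulant φ ψ n fun _ => X

/-- `(1/z) f(z)` for a power series `f` without constant term. -/
def divZ (f : PowerSeries ℂ) : PowerSeries ℂ :=
  PowerSeries.mk fun n => PowerSeries.coeff (n + 1) f

lemma X_mul_divZ_cRTransform (φ ψ : A →ₗ[ℂ] ℂ) (X : A) :
    PowerSeries.X * divZ (cRTransform φ ψ X) = cRTransform φ ψ X := by
  ext n
  cases n with
  | zero => simp [cRTransform]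
  | succ n => simp [PowerSeries.coeff_succ_X_mul, divZ]

lemma constantCoeff_RTransform (ψ : A →ₗ[ℂ] ℂ) (X : A) :
    PowerSeries.constantCoeff (RTransform ψ X) = 0 := by
  simp [RTransform, ← PowerSeries.coeff_zero_eq_constantCoeff_apply]

lemma coeff_one_RTransform (ψ : A →ₗ[ℂ] ℂ) (X : A) :
    PowerSeries.coeff 1 (RTransform ψ X) = ψ X := by
  have : IsEmpty {c : Composition 1 // c.length < 1} :=
    ⟨fun c => by have := c.1.length_pos_iff.mpr one_pos; have := c.2; omega⟩
  rw [RTransform, PowerSeries.coeff_mk, if_neg one_ne_zero, freeCumulant]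
  simp

/-- The substitutional inverse `R_X^{⟨-1⟩}`, which exists when `ψ(X) ≠ 0`. -/
def RInverse (ψ : A →ₗ[ℂ] ℂ) (X : A) (hX : ψ X ≠ 0) : PowerSeries ℂ :=
  (RTransform ψ X).substInvOfIsUnit ((coeff_one_RTransform ψ X).symm ▸ hX.isUnit)

/-- `RInverse` is the two-sided inverse of `R_X` for substitution
(`PowerSeries.subst g f` is `f(g(z))`). -/
theorem RInverse_spec (ψ : A →ₗ[ℂ] ℂ) (X : A) (hX : ψ X ≠ 0) :
    PowerSeries.constantCoeff (RInverse ψ X hX) = 0 ∧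
    PowerSeries.subst (RInverse ψ X hX) (RTransform ψ X) = PowerSeries.X ∧
    PowerSeries.subst (RTransform ψ X) (RInverse ψ X hX) = PowerSeries.X :=
  ⟨PowerSeries.constantCoeff_substInvOfIsUnit _ _,
    PowerSeries.subst_substInvOfIsUnit_right _ (constantCoeff_RTransform ψ X) _,
    PowerSeries.subst_substInvOfIsUnit_left _ (constantCoeff_RTransform ψ X) _⟩

/-- The c-free `T`-transform `ᶜT_X = ((1/z) ᶜR_X) ∘ R_X^{⟨-1⟩}` of an element with `ψ(X) ≠ 0`
(`PowerSeries.subst g f` is `f(g(z))`). -/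
def cTTransform (φ ψ : A →ₗ[ℂ] ℂ) (X : A) (hX : ψ X ≠ 0) : PowerSeries ℂ :=
  PowerSeries.subst (RInverse ψ X hX) (divZ (cRTransform φ ψ X))

end CFreeProb

end

noncomputable section

namespace CFreeProb

open PowerSeries

variable {A : Type*} [Ring A] [Algebra ℂ A]

/-! ### Sums over compositions -/

/-! Work with resolvents over formal series in a variable `t`. Choose `x(t)`, `y(t)` at which the
`ψ`-moment series of `a`, `b` equal `1 + t`, and let `p`, `q` be the `φ`-moment series there. The
moment-cumulant recurrence gives `R_a^{⟨-1⟩} = x (1 + t)` and `ᶜT_a = (p - 1) / (x p)`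
(`cTTransform_mul_mul_subst`). The resolvents are `(1 - x a)⁻¹ = 1 + t + t a'` and `(1 - y b)⁻¹ = 1
+ t + t b'`, with `a'`, `b'` centred for `ψ`. If `t z = x y (1 + t)`, then `1 - z a b` factors
through them and `1 - t (1 + t)⁻¹ a' b'` (`smul_one_sub_smul_mul_eq`). Its inverse is thus a
geometric series in alternating centred words, on which c-freeness makes `φ` multiplicative. This
yields `P`, the `φ`-moment series of `a b` at `z`, from `p` and `q`
(`CFree.subst_momentSeries_mul`). The case `φ = ψ` shows that `z` is the right point for `a b`; the
general case is the product formula for `(P - 1) / (z P)`. -/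

lemma sum_composition_eq_sum_finsuppAntidiag (n : ℕ) (F : (p : ℕ) → (Fin p → ℕ) → ℂ)
    (hF : ∀ p l k, l k = 0 → F p l = 0) :
    ∑ c : Composition n, F c.length c.blocksFun =
      ∑ p ∈ Finset.range (n + 1), ∑ l ∈ Finset.finsuppAntidiag (Finset.univ : Finset (Fin p)) n,
        F p l := by
  classical
  rw [Finset.sum_sigma']
  refine Finset.sum_of_injOn
    (fun c => ⟨c.length, Finsupp.equivFunOnFinite.symm c.blocksFun⟩) ?_ ?_ ?_ ?_
  · intro c _ c' _ h
    obtain ⟨h₁, h₂⟩ := Sigma.mk.inj_iff.mp h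
    have key : ∀ (p q : ℕ) (l : Fin p → ℕ) (m : Fin q → ℕ), p = q →
        HEq (Finsupp.equivFunOnFinite.symm l) (Finsupp.equivFunOnFinite.symm m) →
        List.ofFn l = List.ofFn m := by
      rintro p q l m rfl h
      rw [Finsupp.equivFunOnFinite.symm.injective (eq_of_heq h)]
    have := key _ _ _ _ h₁ h₂
    rw [Composition.ofFn_blocksFun, Composition.ofFn_blocksFun] at this
    exact Composition.ext this
  · intro c _
    simp only [Finset.coe_sigma, Set.mem_sigma_iff, Finset.mem_coe, Finset.mem_range,
      Finset.mem_finsuppAntidiag, Finset.subset_univ, and_true]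
    exact ⟨Nat.lt_succ_of_le c.length_le, c.sum_blocksFun⟩
  · rintro ⟨p, l⟩ hl hnot
    simp only [Finset.mem_sigma, Finset.mem_range, Finset.mem_finsuppAntidiag] at hl
    by_contra h0
    refine hnot ⟨⟨List.ofFn l, ?_, ?_⟩, Finset.mem_coe.mpr (Finset.mem_univ _), ?_⟩
    · intro i hi
      obtain ⟨k, rfl⟩ := (List.mem_ofFn' _ _).mp hi
      exact Nat.pos_of_ne_zero fun hk => h0 (hF p l k hk)
    · rw [List.sum_ofFn]
      exact hl.2.1
    · have key : ∀ (q : ℕ) (m : Fin q → ℕ), List.ofFn m = List.ofFn l →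
          (⟨q, Finsupp.equivFunOnFinite.symm m⟩ : Σ p : ℕ, Fin p →₀ ℕ) = ⟨p, l⟩ := by
        intro q m h
        have := List.ofFn_inj'.mp h
        obtain ⟨rfl, h₂⟩ := Sigma.mk.inj_iff.mp this
        rw [eq_of_heq h₂]
        simp
      exact key _ _ (Composition.ofFn_blocksFun _)
  · intro c _
    rfl

lemma constantCoeff_X_mul (f : PowerSeries ℂ) : constantCoeff (X * f) = 0 := by
  simp

/-- A block of size `m` contributes coefficient `m` of `X * f`, or of `X * g` for the last block.
These series have no constant term, so compositions may be replaced by arbitrary tuples, whose sum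
is a coefficient of a product. The last block's `X` lowers the degree from `n + 1` to `n`. -/
lemma sum_composition_eq_coeff (f g : PowerSeries ℂ) (K : ℕ → ℂ) (n : ℕ) :
    ∑ c : Composition (n + 1), K c.length *
      ∏ k : Fin c.length, (if (k : ℕ) + 1 = c.length then coeff (c.blocksFun k - 1) g
        else coeff (c.blocksFun k - 1) f) =
      ∑ p ∈ Finset.range (n + 1), K (p + 1) * coeff n ((X * f) ^ p * g) := by
  classical
  have h := sum_composition_eq_sum_finsuppAntidiag (n + 1)
    (fun p l => K p * ∏ k : Fin p, coeff (l k) (X * if (k : ℕ) + 1 = p then g else f))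
    (fun p l k hk => by
      rw [Finset.prod_eq_zero (Finset.mem_univ k), mul_zero]
      rw [hk, coeff_zero_eq_constantCoeff_apply, constantCoeff_X_mul])
  refine Eq.trans (Finset.sum_congr rfl fun c _ => ?_) (h.trans ?_)
  · congr 1
    refine Finset.prod_congr rfl fun k _ => ?_
    obtain ⟨m, hm⟩ := Nat.exists_eq_add_of_lt (c.blocks_pos' k k.2)
    have hm : c.blocksFun k = m + 1 := by
      have : c.blocksFun k = c.blocks[(k : ℕ)]'k.2 := rfl
      omega
    rw [hm, coeff_succ_X_mul, Nat.add_sub_cancel]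
    split_ifs <;> rfl
  · simp_rw [← Finset.mul_sum, ← PowerSeries.coeff_prod]
    rw [Finset.sum_range_succ']
    simp only [Finset.univ_eq_empty, Finset.prod_empty]
    rw [coeff_one, if_neg (Nat.succ_ne_zero n), mul_zero, add_zero]
    refine Finset.sum_congr rfl fun p _ => ?_
    congr 1
    rw [Fin.prod_univ_castSucc]
    have : ∀ k : Fin p, (X * if ((k.castSucc : Fin (p + 1)) : ℕ) + 1 = p + 1 then g else f)
        = X * f := fun k => by
      rw [if_neg]
      simp [k.2.ne]
    simp only [this, Finset.prod_const, Finset.card_univ, Fintype.card_fin, Fin.val_last,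
      if_true]
    rw [mul_left_comm, coeff_succ_X_mul]

/-! ### Substitution into power series in one variable -/

lemma coeff_subst_eq_sum_range {x : PowerSeries ℂ} (hx : constantCoeff x = 0)
    (f : PowerSeries ℂ) {n N : ℕ} (hN : n < N) :
    coeff n (f.subst x) = ∑ k ∈ Finset.range N, coeff k f * coeff n (x ^ k) := by
  rw [coeff_subst' (HasSubst.of_constantCoeff_zero' hx)]
  refine (finsum_eq_sum_of_support_subset _ fun k hk => ?_)
  by_contra hkN
  simp only [Finset.coe_range, Set.mem_Iio, not_lt] at hkN
  refine hk ?_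
  have : (X : PowerSeries ℂ) ^ k ∣ x ^ k := pow_dvd_pow_of_dvd (X_dvd_iff.mpr hx) k
  simp [X_pow_dvd_iff.mp this n (hN.trans_le hkN)]

/-! ### Moments and cumulants of one element -/

/-- The series `∑_{n ≥ 0} φ(X^n) z^n`. -/
def momentSeries (φ : A →ₗ[ℂ] ℂ) (a : A) : PowerSeries ℂ :=
  PowerSeries.mk fun n => φ (a ^ n)

lemma coeff_momentSeries (φ : A →ₗ[ℂ] ℂ) (a : A) (n : ℕ) :
    coeff n (momentSeries φ a) = φ (a ^ n) :=
  coeff_mk _ _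

lemma constantCoeff_momentSeries {φ : A →ₗ[ℂ] ℂ} (hφ : φ 1 = 1) (a : A) :
    constantCoeff (momentSeries φ a) = 1 := by
  rw [← coeff_zero_eq_constantCoeff_apply, coeff_momentSeries, pow_zero, hφ]

lemma gap_const {A : Type*} [Ring A] (a : A) {n : ℕ} (c : Composition n) (k : Fin c.length) :
    gap (fun _ => a) c k = a ^ (c.blocksFun k - 1) := by
  simp [gap, List.ofFn_const]

/-- Makes facts about `RTransform` the case `φ = ψ` of facts about `cRTransform`. -/
lemma cFreeCumulant_self (ψ : A →ₗ[ℂ] ℂ) (n : ℕ) (a : Fin n → A) :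
    cFreeCumulant ψ ψ n a = freeCumulant ψ n a := by
  induction n using Nat.strong_induction_on with
  | _ n ih =>
    rw [cFreeCumulant, freeCumulant]
    congr 1
    refine Finset.sum_congr rfl fun c _ => ?_
    rw [ih _ c.2]
    simp

lemma cRTransform_self (ψ : A →ₗ[ℂ] ℂ) (a : A) : cRTransform ψ ψ a = RTransform ψ a := by
  simp only [cRTransform, RTransform, cFreeCumulant_self]

/-- The functional equation of the c-free `R`-transform. -/
lemma subst_divZ_cRTransform_mul {φ ψ : A →ₗ[ℂ] ℂ} (hφ : φ 1 = 1) (hψ : ψ 1 = 1) (a : A) :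
    (divZ (cRTransform φ ψ a)).subst (X * momentSeries ψ a) * (X * momentSeries φ a) =
      momentSeries φ a - 1 := by
  rw [mul_left_comm]
  ext n
  cases n with
  | zero => simp [constantCoeff_momentSeries hφ]
  | succ n =>
    have h := cFreeCumulant_recurrence φ ψ hφ hψ (n + 1) (fun _ => a)
    simp only [gap_const, ← coeff_momentSeries] at h
    rw [sum_composition_eq_coeff (momentSeries ψ a) (momentSeries φ a)
      (fun p => cFreeCumulant φ ψ p fun _ => a)] at h
    rw [coeff_succ_X_mul, map_sub, coeff_one, if_neg n.succ_ne_zero, sub_zero,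
      coeff_momentSeries]
    rw [List.ofFn_const, List.prod_replicate] at h
    rw [h, coeff_mul]
    simp_rw [coeff_mul, Finset.mul_sum]
    rw [Finset.sum_comm]
    refine Finset.sum_congr rfl fun ij hij => ?_
    rw [coeff_subst_eq_sum_range (constantCoeff_X_mul _) _
      (by have := Finset.HasAntidiagonal.mem_antidiagonal.mp hij; omega : ij.1 < n + 1), Finset.sum_mul]
    refine Finset.sum_congr rfl fun p _ => ?_
    simp [divZ, cRTransform, mul_assoc]

lemma subst_RTransform {ψ : A →ₗ[ℂ] ℂ} (hψ : ψ 1 = 1) (a : A) :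
    (RTransform ψ a).subst (X * momentSeries ψ a) = momentSeries ψ a - 1 := by
  have hs := HasSubst.of_constantCoeff_zero' (constantCoeff_X_mul (momentSeries ψ a))
  rw [← cRTransform_self, ← X_mul_divZ_cRTransform, subst_mul hs, subst_X hs,
    ← subst_divZ_cRTransform_mul hψ hψ a, mul_comm]

/-- If `x` satisfies `m_ψ(x) = z`, where `m_ψ` is the series of moments, then `ᶜT` is determined by
`x` and the composition of the moment series of `φ` with `x`. -/
lemma cTTransform_mul_mul_subst {φ ψ : A →ₗ[ℂ] ℂ} (hφ : φ 1 = 1) (hψ : ψ 1 = 1) (a : A)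
    (ha : ψ a ≠ 0) {x : PowerSeries ℂ} (hx : constantCoeff x = 0)
    (h : (momentSeries ψ a).subst x = 1 + X) :
    cTTransform φ ψ a ha * x * (momentSeries φ a).subst x =
      (momentSeries φ a).subst x - 1 := by
  have hsx := HasSubst.of_constantCoeff_zero' hx
  have hsw := HasSubst.of_constantCoeff_zero' (constantCoeff_X_mul (momentSeries ψ a))
  have hsR := HasSubst.of_constantCoeff_zero' (constantCoeff_RTransform ψ a)
  have hsI := HasSubst.of_constantCoeff_zero' (RInverse_spec ψ a ha).1
  have hone : ∀ y : PowerSeries ℂ, HasSubst y → (1 : PowerSeries ℂ).subst y = 1 := fun y hy => by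
    rw [← coe_substAlgHom (R := ℂ) hy, map_one]
  set w := (X * momentSeries ψ a).subst x with hw
  have hw' : w = x * (1 + X) := by rw [hw, subst_mul hsx, subst_X hsx, h]
  have hsw' : HasSubst w := HasSubst.of_constantCoeff_zero' (by simp [hw', hx])
  have hRw : (RTransform ψ a).subst w = X := by
    rw [hw, ← subst_comp_subst_apply hsw hsx, subst_RTransform hψ, subst_sub hsx, h,
      hone x hsx, add_sub_cancel_left]
  -- Applying the inverse series to `R(w) = X` identifies it with `w = x (1 + X)`.
  have hIw : RInverse ψ a ha = w := by
    have h1 := congrArg (fun f => PowerSeries.subst w f) (RInverse_spec ψ a ha).2.2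
    rw [subst_comp_subst_apply hsR hsw', hRw, X_subst, subst_X hsw'] at h1
    exact h1
  have h2 := congrArg (fun f => PowerSeries.subst x f) (subst_divZ_cRTransform_mul hφ hψ a)
  rw [subst_mul hsx, subst_mul hsx, subst_sub hsx, subst_X hsx, hone x hsx,
    subst_comp_subst_apply hsw hsx, ← hw] at h2
  rw [cTTransform, hIw, mul_assoc, h2]

lemma exists_subst_momentSeries_eq {ψ : A →ₗ[ℂ] ℂ} (hψ : ψ 1 = 1) (a : A) (ha : ψ a ≠ 0) :
    ∃ x : PowerSeries ℂ, constantCoeff x = 0 ∧ (momentSeries ψ a).subst x = 1 + X := by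
  have h0 : constantCoeff (momentSeries ψ a - 1) = 0 := by
    simp [constantCoeff_momentSeries hψ]
  have h1 : IsUnit (coeff 1 (momentSeries ψ a - 1)) := by
    simpa [coeff_momentSeries, coeff_one] using ha
  have hx := constantCoeff_substInvOfIsUnit (momentSeries ψ a - 1) h1
  have hsx := HasSubst.of_constantCoeff_zero' hx
  refine ⟨_, hx, ?_⟩
  have h2 := subst_substInvOfIsUnit_right _ h0 h1
  rw [subst_sub hsx, ← coe_substAlgHom (R := ℂ) hsx, map_one, sub_eq_iff_eq_add] at h2
  rw [← coe_substAlgHom (R := ℂ) hsx, h2, add_comm]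

/-- The linear coefficient of the substituted series is `ψ a` times that of `x`, and it has to be
`1`. -/
lemma ne_zero_of_subst_momentSeries_eq {ψ : A →ₗ[ℂ] ℂ} {a : A} {x : PowerSeries ℂ}
    (hx : constantCoeff x = 0) (h : (momentSeries ψ a).subst x = 1 + X) : ψ a ≠ 0 := by
  intro h0
  have h1 := congrArg (coeff 1) h
  rw [coeff_subst_eq_sum_range hx _ (Nat.lt_succ_self 1)] at h1
  simp [Finset.sum_range_succ, coeff_momentSeries, h0, coeff_one] at h1

/-! ### Power series with coefficients in `A` -/

/-- Power series over `A` form an algebra over the scalar power series. -/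
instance scalarSeriesAlgebra : Algebra (PowerSeries ℂ) (PowerSeries A) :=
  (PowerSeries.map (algebraMap ℂ A)).toAlgebra' fun s f => by
    ext n
    rw [coeff_mul, coeff_mul, ← Finset.Nat.sum_antidiagonal_swap]
    refine Finset.sum_congr rfl fun ij _ => ?_
    simp [Algebra.commutes]

lemma coeff_scalarSeries_smul (s : PowerSeries ℂ) (f : PowerSeries A) (n : ℕ) :
    coeff n (s • f) = ∑ ij ∈ Finset.HasAntidiagonal.antidiagonal n, coeff ij.1 s • coeff ij.2 f := by
  rw [Algebra.smul_def, coeff_mul]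
  refine Finset.sum_congr rfl fun ij _ => ?_
  rw [Algebra.smul_def]
  congr 1

lemma constantCoeff_scalarSeries_smul (s : PowerSeries ℂ) (f : PowerSeries A) :
    constantCoeff (s • f) = constantCoeff s • constantCoeff f := by
  rw [← coeff_zero_eq_constantCoeff_apply, coeff_scalarSeries_smul,
    Finset.Nat.antidiagonal_zero, Finset.sum_singleton, coeff_zero_eq_constantCoeff_apply,
    coeff_zero_eq_constantCoeff_apply]

lemma X_smul_eq_mul (f : PowerSeries A) : (X : PowerSeries ℂ) • f = X * f := by
  rw [Algebra.smul_def]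
  congr 1
  exact map_X _

/-- Coefficientwise application of a linear functional. -/
def mapFunctional (φ : A →ₗ[ℂ] ℂ) : PowerSeries A →ₗ[PowerSeries ℂ] PowerSeries ℂ where
  toFun f := PowerSeries.mk fun n => φ (coeff n f)
  map_add' f g := by ext n; simp
  map_smul' s f := by
    ext n
    simp [coeff_scalarSeries_smul, coeff_mul]

lemma coeff_mapFunctional (φ : A →ₗ[ℂ] ℂ) (f : PowerSeries A) (n : ℕ) :
    coeff n (mapFunctional φ f) = φ (coeff n f) :=
  coeff_mk n fun n => φ (coeff n f)

lemma mapFunctional_C (φ : A →ₗ[ℂ] ℂ) (a : A) : mapFunctional φ (C a) = C (φ a) := by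
  ext n
  rw [coeff_mapFunctional, coeff_C, coeff_C]
  split_ifs <;> simp

lemma mapFunctional_one {φ : A →ₗ[ℂ] ℂ} (hφ : φ 1 = 1) :
    mapFunctional φ (1 : PowerSeries A) = 1 := by
  rw [← map_one (C (R := A)), mapFunctional_C, hφ, map_one]

lemma eq_of_forall_X_pow_dvd_sub {f g : PowerSeries ℂ} (h : ∀ N, X ^ N ∣ f - g) : f = g := by
  ext n
  have := X_pow_dvd_iff.mp (h (n + 1)) n n.lt_succ_self
  rwa [map_sub, sub_eq_zero] at this

lemma exists_inverse_one_sub {A : Type*} [Ring A] {f : PowerSeries A}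
    (hf : constantCoeff f = 0) :
    ∃ g : PowerSeries A, (1 - f) * g = 1 ∧ g * (1 - f) = 1 := by
  have h : constantCoeff (1 - f) = ((1 : Aˣ) : A) := by simp [hf]
  exact ⟨invOfUnit (1 - f) 1, mul_invOfUnit _ _ h, invOfUnit_mul _ _ h⟩

/-- The exact remainder replaces convergence: in the applications `t ^ N` is divisible by `X ^ N`.
-/
lemma eq_geom_sum_add {R : Type*} [Ring R] {t g : R} (h : (1 - t) * g = 1) (N : ℕ) :
    g = ∑ k ∈ Finset.range N, t ^ k + t ^ N * g := by
  have := geom_sum_mul_neg t N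
  calc g = ((1 - t ^ N) + t ^ N) * g := by noncomm_ring
    _ = (∑ k ∈ Finset.range N, t ^ k) * ((1 - t) * g) + t ^ N * g := by
      rw [← this, add_mul, mul_assoc]
    _ = _ := by rw [h, mul_one]

/-! ### The resolvent of one element -/

lemma coeff_resolvent {a : A} {x : PowerSeries ℂ} (hx : constantCoeff x = 0)
    {E : PowerSeries A} (hE : (1 - x • C a) * E = 1) (n : ℕ) :
    coeff n E = ∑ k ∈ Finset.range (n + 1), coeff n (x ^ k) • a ^ k := by
  have key : ∀ (s : PowerSeries ℂ) (b : A), coeff n (s • C b) = coeff n s • b := fun s b => by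
    rw [Algebra.smul_def, coeff_mul_C, Algebra.smul_def]
    congr 1
  rw [eq_geom_sum_add hE (n + 1), map_add, map_sum]
  simp_rw [smul_pow, ← map_pow, key]
  rw [add_eq_left, smul_mul_assoc, coeff_scalarSeries_smul]
  refine Finset.sum_eq_zero fun ij hij => ?_
  have h1 : (X : PowerSeries ℂ) ^ (n + 1) ∣ x ^ (n + 1) :=
    pow_dvd_pow_of_dvd (X_dvd_iff.mpr hx) _
  have := Finset.HasAntidiagonal.mem_antidiagonal.mp hij
  rw [X_pow_dvd_iff.mp h1 ij.1 (by omega), zero_smul]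

lemma mapFunctional_resolvent (φ : A →ₗ[ℂ] ℂ) {a : A} {x : PowerSeries ℂ}
    (hx : constantCoeff x = 0) {E : PowerSeries A} (hE : (1 - x • C a) * E = 1) :
    mapFunctional φ E = (momentSeries φ a).subst x := by
  ext n
  rw [coeff_mapFunctional, coeff_resolvent hx hE,
    coeff_subst_eq_sum_range hx _ n.lt_succ_self, map_sum]
  refine Finset.sum_congr rfl fun k _ => ?_
  rw [map_smul, smul_eq_mul, coeff_momentSeries, mul_comm]

/-- The resolvent of `a` at a point where its `ψ`-value is `1 + z` is `1 + z` plus a multiple of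
`z` with `ψ`-centred coefficients in the algebra generated by `a`. -/
lemma exists_resolvent_eq {ψ : A →ₗ[ℂ] ℂ} (hψ : ψ 1 = 1) {a : A} {x : PowerSeries ℂ}
    (hx : constantCoeff x = 0) (h : (momentSeries ψ a).subst x = 1 + X) :
    ∃ E f : PowerSeries A, (1 - x • C a) * E = 1 ∧ E * (1 - x • C a) = 1 ∧
      E = (1 + X : PowerSeries ℂ) • (1 : PowerSeries A) + (X : PowerSeries ℂ) • f ∧
      ∀ n, coeff n f ∈ Algebra.adjoin ℂ {a} ∧ ψ (coeff n f) = 0 := by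
  obtain ⟨E, hE, hE'⟩ := exists_inverse_one_sub (f := x • C a)
    (by rw [constantCoeff_scalarSeries_smul, hx, zero_smul])
  have hmem : ∀ n, coeff n E ∈ Algebra.adjoin ℂ {a} := fun n => by
    rw [coeff_resolvent hx hE]
    exact sum_mem fun k _ => Subalgebra.smul_mem _
      (pow_mem (Algebra.subset_adjoin (Set.mem_singleton a)) k) _
  have hψE := mapFunctional_resolvent ψ hx hE
  rw [h] at hψE
  -- Both terms have constant coefficient `1`. Since `ψ` maps `E` to `1 + X`, the subtraction also
  -- centres every coefficient.
  obtain ⟨f, hf⟩ : X ∣ E - (1 + X : PowerSeries ℂ) • (1 : PowerSeries A) := by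
    rw [X_dvd_iff, map_sub, constantCoeff_scalarSeries_smul, sub_eq_zero,
      ← coeff_zero_eq_constantCoeff_apply E, coeff_resolvent hx hE]
    simp
  have hcoeff : ∀ n, coeff n f = coeff (n + 1) E - coeff (n + 1) (1 + X : PowerSeries ℂ) • 1 := by
    intro n
    rw [← coeff_succ_X_mul, ← hf, map_sub, Algebra.smul_def, mul_one, Algebra.smul_def, mul_one]
    congr 1
  refine ⟨E, f, hE, hE', ?_, fun n => ⟨?_, ?_⟩⟩
  · rw [X_smul_eq_mul, ← hf, add_sub_cancel]
  · rw [hcoeff]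
    exact sub_mem (hmem _) (Subalgebra.smul_mem _ (one_mem _) _)
  · rw [hcoeff, map_sub, map_smul, hψ, ← hψE, coeff_mapFunctional, smul_eq_mul, mul_one, sub_self]

/-! ### Conditional freeness for power series -/

/-- Lets the computation for `φ` be reused for `ψ`. -/
lemma CFree.self {ι : Type*} {φ ψ : A →ₗ[ℂ] ℂ} {B : ι → Subalgebra ℂ A} (h : CFree φ ψ B) :
    CFree ψ ψ B := fun n ε a ha hε hψ => by
  refine ⟨(h n ε a ha hε hψ).1, ?_⟩
  rw [(h n ε a ha hε hψ).1, Finset.prod_eq_zero (Finset.mem_univ 0) (hψ 0)]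

lemma CFree.map_list_prod {ι : Type*} {φ ψ : A →ₗ[ℂ] ℂ} (hφ : φ 1 = 1)
    {B : ι → Subalgebra ℂ A} (h : CFree φ ψ B) (w : List (ι × A))
    (hw : ∀ p ∈ w, p.2 ∈ B p.1 ∧ ψ p.2 = 0) (hc : (w.map Prod.fst).IsChain (· ≠ ·)) :
    φ (w.map Prod.snd).prod = (w.map fun p => φ p.2).prod := by
  obtain hw0 | ⟨n, hn⟩ : w = [] ∨ ∃ n, w.length = n + 1 := by
    cases w <;> simp
  · simp [hw0, hφ]
  · obtain ⟨v, rfl⟩ : ∃ v : Fin (n + 1) → ι × A, w = List.ofFn v := by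
      refine ⟨fun k => w.get (k.cast hn.symm), ?_⟩
      refine List.ext_getElem (by simp [hn]) fun i h₁ h₂ => by simp [-List.ofFn_succ]
    have := (h n (fun k => (v k).1) (fun k => (v k).2)
      (fun k => (hw _ ((List.mem_ofFn' _ _).mpr ⟨k, rfl⟩)).1) (fun k => ?_)
      (fun k => (hw _ ((List.mem_ofFn' _ _).mpr ⟨k, rfl⟩)).2)).2
    · rw [List.map_ofFn, List.map_ofFn, List.prod_ofFn (f := (fun p : ι × A => φ p.2) ∘ v)]
      exact this
    · have := List.isChain_iff_getElem.mp hc k (by simp)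
      simp only [List.map_ofFn, List.getElem_ofFn] at this
      exact this

/-- By multilinearity, the series in `l` are expanded one at a time and their coefficients appended
to the word `w` of elements of `A`; once `l` is empty, c-freeness applies to `w`. -/
lemma CFree.mapFunctional_list_prod {ι : Type*} {φ ψ : A →ₗ[ℂ] ℂ} (hφ : φ 1 = 1)
    {B : ι → Subalgebra ℂ A} (h : CFree φ ψ B) (l : List (ι × PowerSeries A)) :
    ∀ w : List (ι × A), (∀ p ∈ w, p.2 ∈ B p.1 ∧ ψ p.2 = 0) →
      (∀ p ∈ l, ∀ n, coeff n p.2 ∈ B p.1 ∧ ψ (coeff n p.2) = 0) →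
      (w.map Prod.fst ++ l.map Prod.fst).IsChain (· ≠ ·) →
      mapFunctional φ (C (w.map Prod.snd).prod * (l.map Prod.snd).prod) =
        C (w.map fun p => φ p.2).prod * (l.map fun p => mapFunctional φ p.2).prod := by
  induction l with
  | nil =>
    intro w hw _ hc
    simp only [List.map_nil, List.prod_nil, mul_one, List.append_nil] at hc ⊢
    rw [mapFunctional_C, h.map_list_prod hφ w hw hc]
  | cons p l ih =>
    intro w hw hl hc
    have key : ∀ n, mapFunctional φ
        (C ((w.map Prod.snd).prod * coeff n p.2) * (l.map Prod.snd).prod) =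
        C ((w.map fun p => φ p.2).prod * φ (coeff n p.2)) *
          (l.map fun p => mapFunctional φ p.2).prod := by
      intro n
      have := ih (w ++ [(p.1, coeff n p.2)]) ?_ (fun q hq => hl q (List.mem_cons_of_mem _ hq)) ?_
      · simpa using this
      · intro q hq
        rcases List.mem_append.mp hq with hq | hq
        · exact hw q hq
        · rw [List.mem_singleton.mp hq]
          exact hl p List.mem_cons_self n
      · simpa using hc
    ext n
    rw [List.map_cons, List.prod_cons, List.map_cons, List.prod_cons, coeff_mapFunctional,
      coeff_C_mul, coeff_C_mul, coeff_mul, coeff_mul, Finset.mul_sum, Finset.mul_sum, map_sum]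
    refine Finset.sum_congr rfl fun ij _ => ?_
    have := congrArg (coeff ij.2) (key ij.1)
    rw [coeff_mapFunctional, coeff_C_mul, coeff_C_mul] at this
    rw [← mul_assoc, this, coeff_mapFunctional, mul_assoc]

/-! ### The resolvent of a product -/

/-- The chain flanked by `j` and `i` records that the word stays alternating with `b` put in front,
`a` put behind, or both, also for `k = 0`. -/
lemma exists_alternating_list {ι R S : Type*} [Monoid R] [Monoid S] (Φ : R → S) {i j : ι}
    (hij : i ≠ j) (a b : R) (k : ℕ) :
    ∃ l : List (ι × R), (∀ p ∈ l, p = (i, a) ∨ p = (j, b)) ∧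
      (l.map Prod.snd).prod = (a * b) ^ k ∧
      (l.map fun p => Φ p.2).prod = (Φ a * Φ b) ^ k ∧
      (j :: (l.map Prod.fst ++ [i])).IsChain (· ≠ ·) := by
  induction k with
  | zero => exact ⟨[], by simp [hij.symm]⟩
  | succ k ih =>
    obtain ⟨l, h₁, h₂, h₃, h₄⟩ := ih
    refine ⟨(i, a) :: (j, b) :: l, ?_, ?_, ?_, ?_⟩
    · simpa using h₁
    · simp [h₂, pow_succ', mul_assoc]
    · simp [h₃, pow_succ', mul_assoc]
    · simp only [List.map_cons, List.cons_append, List.isChain_cons_cons]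
      exact ⟨hij.symm, hij, h₄⟩

lemma CFree.mapFunctional_alternating {ι : Type*} {φ ψ : A →ₗ[ℂ] ℂ} (hφ : φ 1 = 1)
    {B : ι → Subalgebra ℂ A} (h : CFree φ ψ B) {i j : ι} (hij : i ≠ j) {a b : PowerSeries A}
    (ha : ∀ n, coeff n a ∈ B i ∧ ψ (coeff n a) = 0)
    (hb : ∀ n, coeff n b ∈ B j ∧ ψ (coeff n b) = 0) (v w : PowerSeries ℂ) (k : ℕ) :
    mapFunctional φ ((v • (1 : PowerSeries A) + w • b) * (a * b) ^ k * (v • 1 + w • a)) =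
      (v + w * mapFunctional φ b) * (mapFunctional φ a * mapFunctional φ b) ^ k *
        (v + w * mapFunctional φ a) := by
  obtain ⟨l, h₁, h₂, h₃, h₄⟩ := exists_alternating_list (mapFunctional φ) hij a b k
  -- The product expands into four words, each an infix of the longest one, `b (a b)^k a`.
  have key : ∀ m : List (ι × PowerSeries A), (∀ p ∈ m, p = (i, a) ∨ p = (j, b)) →
      m.map Prod.fst <:+: j :: (l.map Prod.fst ++ [i]) →
      mapFunctional φ (m.map Prod.snd).prod = (m.map fun p => mapFunctional φ p.2).prod := by
    intro m hm hinf
    have := h.mapFunctional_list_prod hφ m [] (by simp) (fun p hp => by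
      rcases hm p hp with rfl | rfl
      exacts [ha, hb]) (by simpa using h₄.infix hinf)
    simpa using this
  have k₀ := key l h₁ ⟨[j], [i], by simp⟩
  have k₁ := key ((j, b) :: l) (by simpa using h₁) ⟨[], [i], by simp⟩
  have k₂ := key (l ++ [(i, a)]) (by
    intro p hp
    rcases List.mem_append.mp hp with hp | hp
    exacts [h₁ p hp, Or.inl (List.mem_singleton.mp hp)]) ⟨[j], [], by simp⟩
  have k₃ := key ((j, b) :: (l ++ [(i, a)])) (by
    intro p hp
    rcases List.mem_cons.mp hp with hp | hp
    · exact Or.inr hp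
    rcases List.mem_append.mp hp with hp | hp
    exacts [h₁ p hp, Or.inl (List.mem_singleton.mp hp)]) ⟨[], [], by simp⟩
  simp only [List.map_cons, List.map_append, List.map_nil, List.prod_cons, List.prod_append,
    List.prod_nil, mul_one, h₂, h₃] at k₀ k₁ k₂ k₃
  simp only [add_mul, mul_add, smul_mul_assoc, mul_smul_comm, one_mul, mul_one, map_add, map_smul,
    mul_assoc, smul_eq_mul, k₀, k₁, k₂, k₃]
  ring

lemma mapFunctional_mul_geom_mul (φ : A →ₗ[ℂ] ℂ) {F G E d : PowerSeries A}
    {f e δ : PowerSeries ℂ} (hG : (1 - (X : PowerSeries ℂ) • d) * G = 1)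
    (h : ∀ k, mapFunctional φ (F * d ^ k * E) = f * δ ^ k * e) :
    mapFunctional φ (F * G * E) * (1 - X * δ) = f * e := by
  refine eq_of_forall_X_pow_dvd_sub fun N => ?_
  have h1 : F * G * E = ∑ k ∈ Finset.range N, (X : PowerSeries ℂ) ^ k • (F * d ^ k * E) +
      (X : PowerSeries ℂ) ^ N • (F * (d ^ N * G) * E) := by
    conv_lhs => rw [eq_geom_sum_add hG N]
    simp only [mul_add, add_mul, Finset.mul_sum, Finset.sum_mul, smul_pow, smul_mul_assoc,
      mul_smul_comm]
  have h2 : mapFunctional φ (F * G * E) =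
      f * (∑ k ∈ Finset.range N, (X * δ) ^ k) * e +
        X ^ N * mapFunctional φ (F * (d ^ N * G) * E) := by
    rw [h1, map_add, map_sum, map_smul, smul_eq_mul, Finset.mul_sum, Finset.sum_mul]
    congr 1
    refine Finset.sum_congr rfl fun k _ => ?_
    rw [map_smul, h, smul_eq_mul]
    ring
  have h3 := geom_sum_mul_neg (X * δ) N
  refine ⟨mapFunctional φ (F * (d ^ N * G) * E) * (1 - X * δ) - f * e * δ ^ N, ?_⟩
  rw [h2]
  linear_combination (f * e) * h3

lemma X_smul_injective : Function.Injective fun f : PowerSeries A => (X : PowerSeries ℂ) • f := by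
  intro f g h
  simp only [X_smul_eq_mul] at h
  ext n
  rw [← coeff_succ_X_mul, h, coeff_succ_X_mul]

/-- Factorization of `1 - z a b` through the resolvents of `a` and `b`. -/
lemma smul_one_sub_smul_mul_eq {S R : Type*} [CommRing S] [Ring R] [Algebra S R]
    {a b E F a' b' : R} {t x y z s : S} (hz : t * z = x * y * (1 + t)) (hs : (1 + t) * s = 1)
    (hE : (1 - x • a) * E = 1) (hF : F * (1 - y • b) = 1)
    (hEa : E = (1 + t) • (1 : R) + t • a') (hFb : F = (1 + t) • (1 : R) + t • b') :
    t • (1 - z • (a * b)) =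
      t • ((1 - x • a) * ((1 + t) • (1 - t • (s • (a' * b')))) * (1 - y • b)) := by
  obtain ⟨p, hp⟩ : ∃ p, p = 1 - x • a := ⟨_, rfl⟩
  obtain ⟨q, hq⟩ : ∃ q, q = 1 - y • b := ⟨_, rfl⟩
  rw [← hp] at hE ⊢
  rw [← hq] at hF ⊢
  have ha : t • a' = E - (1 + t) • 1 := by rw [hEa, add_sub_cancel_left]
  have hb : t • b' = F - (1 + t) • 1 := by rw [hFb, add_sub_cancel_left]
  have hpa : p * (t • a') = 1 - (1 + t) • p := by
    rw [ha, mul_sub, hE, mul_smul_comm, mul_one]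
  have hqb : (t • b') * q = 1 - (1 + t) • q := by
    rw [hb, sub_mul, hF, smul_mul_assoc, one_mul]
  have hc : t • ((1 + t) • (1 - t • (s • (a' * b')))) =
      (t * (1 + t)) • (1 : R) - (t • a') * (t • b') := by
    rw [smul_mul_smul_comm, smul_sub, smul_sub, smul_smul, smul_smul, smul_smul, smul_smul,
      show t * (1 + t) * t * s = t * t * ((1 + t) * s) by ring, hs, mul_one]
  -- The right side is now `t (1 + t) p q - (1 - (1 + t) p) (1 - (1 + t) q)`, which equals `t - (1 +
  -- t) (1 - p) (1 - q)`, with `1 - p = x a` and `1 - q = y b`.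
  rw [← smul_mul_assoc t (p * _) q, ← mul_smul_comm t p, hc, mul_sub, sub_mul, ← mul_assoc, hpa,
    mul_assoc (1 - (1 + t) • p), hqb, smul_sub, smul_smul, hz, hp, hq]
  simp only [mul_sub, sub_mul, smul_sub, mul_smul_comm, smul_mul_assoc, mul_one, one_mul,
    smul_smul]
  module

/-- Multiplicativity of c-free convolution in terms of moment series, composed with series
`x`, `y`, `z` at which the `ψ`-moment series agree. -/
lemma CFree.subst_momentSeries_mul {φ ψ : A →ₗ[ℂ] ℂ} (hφ : φ 1 = 1) (hψ : ψ 1 = 1) {a b : A}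
    (h : CFree φ ψ ![Algebra.adjoin ℂ {a}, Algebra.adjoin ℂ {b}]) {x y z : PowerSeries ℂ}
    (hx : constantCoeff x = 0) (hy : constantCoeff y = 0) (hz : constantCoeff z = 0)
    (hxa : (momentSeries ψ a).subst x = 1 + X) (hyb : (momentSeries ψ b).subst y = 1 + X)
    (hxyz : X * z = x * y * (1 + X)) :
    (momentSeries φ (a * b)).subst z *
      (X * (1 + X) - ((momentSeries φ a).subst x - (1 + X)) *
        ((momentSeries φ b).subst y - (1 + X))) =
      X * (momentSeries φ a).subst x * (momentSeries φ b).subst y := by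
  obtain ⟨E, a', hE, hE', hEa, ha'⟩ := exists_resolvent_eq hψ hx hxa
  obtain ⟨F, b', hF, hF', hFb, hb'⟩ := exists_resolvent_eq hψ hy hyb
  obtain ⟨s, hs⟩ : ∃ s : PowerSeries ℂ, (1 + X) * s = 1 :=
    ⟨(1 + X)⁻¹, PowerSeries.mul_inv_cancel _ (by simp)⟩
  obtain ⟨G, hG, -⟩ := exists_inverse_one_sub (f := (X : PowerSeries ℂ) • (s • (a' * b')))
    (by rw [constantCoeff_scalarSeries_smul]; simp)
  have hfac := X_smul_injective (smul_one_sub_smul_mul_eq hxyz hs hE hF' hEa hFb)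
  rw [← map_mul] at hfac
  -- Inverting the three factors reverses their order, so `F` comes before `E` and the words begin
  -- with `b'` and end with `a'`.
  have hH : (1 - z • C (a * b)) * (s • (F * G * E)) = 1 := by
    rw [hfac, mul_smul_comm, mul_smul_comm, smul_mul_assoc, smul_mul_assoc, smul_smul, mul_comm s,
      hs, one_smul]
    calc _ = (1 - x • C a) * ((1 - (X : PowerSeries ℂ) • (s • (a' * b'))) *
          ((1 - y • C b) * F) * G) * E := by simp only [mul_assoc]
      _ = 1 := by rw [hF, mul_one, hG, mul_one, hE]
  have hP := mapFunctional_resolvent φ hz hH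
  rw [map_smul, smul_eq_mul] at hP
  have hp := mapFunctional_resolvent φ hx hE
  have hq := mapFunctional_resolvent φ hy hF
  rw [hEa, map_add, map_smul, map_smul, mapFunctional_one hφ, smul_eq_mul, smul_eq_mul,
    mul_one] at hp
  rw [hFb, map_add, map_smul, map_smul, mapFunctional_one hφ, smul_eq_mul, smul_eq_mul,
    mul_one] at hq
  have hFGE := mapFunctional_mul_geom_mul φ (F := F) (E := E) hG
    (f := 1 + X + X * mapFunctional φ b') (e := 1 + X + X * mapFunctional φ a')
    (δ := s * (mapFunctional φ a' * mapFunctional φ b')) fun k => by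
      have := h.mapFunctional_alternating hφ (i := 0) (j := 1) (by decide) (a := a') (b := b')
        ha' hb' (1 + X) X k
      rw [smul_pow, mul_smul_comm, smul_mul_assoc, map_smul, hEa, hFb, this, smul_eq_mul]
      ring
  rw [← hP, ← hp, ← hq]
  linear_combination X * hFGE + (X * mapFunctional φ (F * G * E)) * hs

end CFreeProb

end

theorem mainTheorem1 {A : Type*} [Ring A] [Algebra ℂ A] (φ ψ : A →ₗ[ℂ] ℂ)
    (hφ : φ 1 = 1) (hψ : ψ 1 = 1) (X Y : A) (hXY : CFreeProb.CFreePair φ ψ X Y)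
    (hX : ψ X ≠ 0) (hY : ψ Y ≠ 0) :
    ∃ h : ψ (X * Y) ≠ 0,
      CFreeProb.cTTransform φ ψ (X * Y) h =
        CFreeProb.cTTransform φ ψ X hX * CFreeProb.cTTransform φ ψ Y hY := by
  obtain ⟨x, hx, hxX⟩ := CFreeProb.exists_subst_momentSeries_eq hψ X hX
  obtain ⟨y, hy, hyY⟩ := CFreeProb.exists_subst_momentSeries_eq hψ Y hY
  -- Writing `y = X y'` makes `z = x y (1 + X) / X` a power series.
  obtain ⟨y', rfl⟩ := PowerSeries.X_dvd_iff.mpr hy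
  set z := x * y' * (1 + PowerSeries.X) with hz_def
  have hz : PowerSeries.constantCoeff z = 0 := by simp [hz_def, hx]
  have hxyz : PowerSeries.X * z = x * (PowerSeries.X * y') * (1 + PowerSeries.X) := by
    rw [hz_def]; ring
  have hψz := CFreeProb.CFree.subst_momentSeries_mul hψ hψ (CFreeProb.CFree.self hXY)
    hx hy hz hxX hyY hxyz
  have hone : (1 + PowerSeries.X : PowerSeries ℂ) ≠ 0 := fun h0 => by
    simpa using congrArg PowerSeries.constantCoeff h0
  have hzXY : (CFreeProb.momentSeries ψ (X * Y)).subst z = 1 + PowerSeries.X := by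
    -- For `φ = ψ` both `p` and `q` equal `1 + X`, so the correction term vanishes.
    rw [hxX, hyY] at hψz
    refine mul_right_cancel₀ (mul_ne_zero PowerSeries.X_ne_zero hone) ?_
    linear_combination hψz
  have hne : ψ (X * Y) ≠ 0 := CFreeProb.ne_zero_of_subst_momentSeries_eq hz hzXY
  refine ⟨hne, ?_⟩
  have hφz := CFreeProb.CFree.subst_momentSeries_mul hφ hψ hXY hx hy hz hxX hyY hxyz
  have hTX := CFreeProb.cTTransform_mul_mul_subst hφ hψ X hX hx hxX
  have hTY := CFreeProb.cTTransform_mul_mul_subst hφ hψ Y hY hy hyY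
  have hTXY := CFreeProb.cTTransform_mul_mul_subst hφ hψ (X * Y) hne hz hzXY
  have hM : ∀ (a : A) (u : PowerSeries ℂ), PowerSeries.constantCoeff u = 0 →
      (CFreeProb.momentSeries φ a).subst u ≠ (0 : PowerSeries ℂ) := fun a u hu h0 => by
    have := congrArg (PowerSeries.coeff 0) h0
    rw [CFreeProb.coeff_subst_eq_sum_range hu _ zero_lt_one] at this
    simp [CFreeProb.coeff_momentSeries, hφ] at this
  have hz0 : z ≠ 0 := by
    rintro h0
    have h1 := congrArg (PowerSeries.coeff 1) hzXY
    rw [CFreeProb.coeff_subst_eq_sum_range hz _ (Nat.lt_succ_self 1), h0] at h1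
    simp [Finset.sum_range_succ, PowerSeries.coeff_one] at h1
  have hpX := hM X x hx
  have hpY := hM Y _ hy
  have hpXY := hM (X * Y) z hz
  generalize (CFreeProb.momentSeries φ (X * Y)).subst z = P at *
  generalize (CFreeProb.momentSeries φ X).subst x = p at *
  generalize (CFreeProb.momentSeries φ Y).subst (PowerSeries.X * y') = q at *
  generalize CFreeProb.cTTransform φ ψ (X * Y) hne = T at *
  generalize CFreeProb.cTTransform φ ψ X hX = T₁ at *
  generalize CFreeProb.cTTransform φ ψ Y hY = T₂ at *
  -- Dividing by `P z X p q` and using `X z = x y (1 + X)` gives `(P - 1) / (z P) = (p - 1) / (x p)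
  -- * ((q - 1) / (y q))`.
  have key : (P - 1) * (PowerSeries.X * p * q) = P * (1 + PowerSeries.X) * (p - 1) * (q - 1) := by
    linear_combination hφz
  rw [← hTXY, ← hTX, ← hTY] at key
  refine mul_right_cancel₀ (mul_ne_zero (mul_ne_zero hpXY hz0)
    (mul_ne_zero (mul_ne_zero PowerSeries.X_ne_zero hpX) hpY)) ?_
  linear_combination key - (T₁ * T₂ * P * p * q) * hxyz
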